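/- For a partition $\lambda$ of $n$, let $(\rho_\lambda,V_\lambda)$ be the irreducible complex representation of the symmetric group $S_n$ corresponding to $\lambda$ (so that $(n)$ corresponds to the trivial and $(1^n)$ to the sign representation). Call $\lambda$ \emph{chiral} if $\det\circ\rho_\lambda$ is the sign character of $S_n$ and is non-trivial (for $n\ge 2$ the sign character is automatically non-trivial, so the second condition only says that the partition of $1$ is not chiral). For integers $a,b\ge 0$ let $h(a,b)=(a+1,1^b)$, a partition of $a+b+1$; these partitions are called hooks. Let $\nu(m)$ denote the number of digits $1$ in the binary expansion of $m$. \textbf{Theorem.} For all integers $a,b\ge 0$, the hook $h(a,b)$ is chiral if and only if $b>0$ and the binomial coefficient $\binom{a+b-1}{a}$ is odd. Consequently, for every integer $n\ge 2$, the number of chiral hooks of size $n$ is $2^{\nu(n-2)}$. -/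

import Mathlib

/-! Partitions of `n` are represented by their Young diagrams `μ` with `μ.card = n`.  The complex
irreducible representation of the symmetric group attached to `μ` is its Specht module. -/

/-- A (Young) tableau of shape `μ` with entries in `Fin n`: a bijective filling of the cells.
(There are none unless `n = μ.card`.) -/
abbrev YoungTableau (μ : YoungDiagram) (n : ℕ) : Type := μ.cells ≃ Fin n

namespace YoungTableau

variable {μ : YoungDiagram} {n : ℕ}

/-- The row of the entry `x` in the tableau `T`. -/
def rowOf (T : YoungTableau μ n) (x : Fin n) : ℕ := (T.symm x).1.1

/-- The column of the entry `x` in the tableau `T`. -/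
def colOf (T : YoungTableau μ n) (x : Fin n) : ℕ := (T.symm x).1.2

/-- The column stabilizer of a tableau. -/
def colStabilizer (T : YoungTableau μ n) : Subgroup (Equiv.Perm (Fin n)) where
  carrier := {σ | ∀ x, T.colOf (σ x) = T.colOf x}
  mul_mem' {σ τ} hσ hτ x := by
    rw [Equiv.Perm.mul_apply]
    exact (hσ (τ x)).trans (hτ x)
  one_mem' _ := rfl
  inv_mem' {σ} hσ x := by
    have h := hσ (σ⁻¹ x)
    have e : σ (σ⁻¹ x) = x := Equiv.apply_symm_apply σ x
    rw [e] at h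
    exact h.symm

end YoungTableau

/-- The permutation representation of `S_n` on the complex vector space with basis all functions
`f : Fin n → ℕ`, where `σ • f = f ∘ σ⁻¹`.

Two tableaux of shape `μ` are row equivalent iff they have the same function `rowOf`, so the
tabloid `{T}` is encoded by the basis vector `T.rowOf`; the span of these is the
usual permutation module on tabloids of shape `μ`. -/
noncomputable def rowAssignmentRep (n : ℕ) :
    Representation ℂ (Equiv.Perm (Fin n)) ((Fin n → ℕ) →₀ ℂ) where
  toFun σ := Finsupp.lmapDomain ℂ ℂ fun f => f ∘ ⇑σ⁻¹
  map_one' := by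
    ext f
    simp
  map_mul' σ τ := by
    ext f
    simp [Finsupp.mapDomain_single, Function.comp_assoc]

open Classical in
/-- The polytabloid `e_T = ∑ sgn(σ) {σ T}`, summed over the column stabilizer of `T`. -/
noncomputable def polytabloid {μ : YoungDiagram} {n : ℕ} (T : YoungTableau μ n) :
    (Fin n → ℕ) →₀ ℂ :=
  ∑ σ : T.colStabilizer,
    Finsupp.single (YoungTableau.rowOf (T.trans (σ : Equiv.Perm (Fin n))))
      ((Equiv.Perm.sign (σ : Equiv.Perm (Fin n)) : ℤ) : ℂ)

theorem rowAssignmentRep_polytabloid {μ : YoungDiagram} {n : ℕ} (T : YoungTableau μ n)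
    (g : Equiv.Perm (Fin n)) :
    rowAssignmentRep n g (polytabloid T) = polytabloid (T.trans g) := by
  classical
  unfold polytabloid
  rw [map_sum]
  refine Finset.sum_bij'
    (fun σ _ => ⟨g * (σ : Equiv.Perm (Fin n)) * g⁻¹, ?_⟩)
    (fun σ _ => ⟨g⁻¹ * (σ : Equiv.Perm (Fin n)) * g, ?_⟩) ?_ ?_ ?_ ?_ ?_
  · intro x
    have h := σ.2 (g⁻¹ x)
    simpa [YoungTableau.colOf] using h
  · intro x
    have h := σ.2 (g x)
    simpa [YoungTableau.colOf] using h
  · simp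
  · simp
  · intro σ _
    ext1
    simp [mul_assoc]
  · intro σ _
    ext1
    simp [mul_assoc]
  · intro σ _
    have hs : Equiv.Perm.sign (g * (σ : Equiv.Perm (Fin n)) * g⁻¹)
        = Equiv.Perm.sign (σ : Equiv.Perm (Fin n)) := by
      rw [Equiv.Perm.sign_mul, Equiv.Perm.sign_mul, Equiv.Perm.sign_inv, mul_comm, ← mul_assoc,
        Int.units_mul_self, one_mul]
    have hr : YoungTableau.rowOf (T.trans (σ : Equiv.Perm (Fin n))) ∘ ⇑g⁻¹
        = YoungTableau.rowOf ((T.trans g).trans (g * (σ : Equiv.Perm (Fin n)) * g⁻¹)) := by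
      funext x
      simp [YoungTableau.rowOf, Equiv.Perm.mul_def, Equiv.Perm.inv_def]
    simp only [hs, ← hr]
    simp [rowAssignmentRep, Finsupp.mapDomain_single]

/-- The Specht module of shape `μ` as a subrepresentation: the span of all polytabloids. -/
noncomputable def spechtModule (μ : YoungDiagram) (n : ℕ) :
    Subrepresentation (rowAssignmentRep n) where
  toSubmodule := Submodule.span ℂ (Set.range (polytabloid (μ := μ) (n := n)))
  apply_mem_toSubmodule g v hv := by
    induction hv using Submodule.span_induction with
    | mem v hv =>
      obtain ⟨T, rfl⟩ := hv
      rw [rowAssignmentRep_polytabloid]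
      exact Submodule.subset_span ⟨_, rfl⟩
    | zero => simp
    | add x y _ _ hx hy => rw [map_add]; exact Submodule.add_mem _ hx hy
    | smul c x _ hx => rw [map_smul]; exact Submodule.smul_mem _ c hx

/-- The Specht representation `V_μ` of `S_n`, where `n = μ.card`. -/
noncomputable def spechtRep (μ : YoungDiagram) :
    Representation ℂ (Equiv.Perm (Fin μ.card)) (spechtModule μ μ.card).toSubmodule :=
  (spechtModule μ μ.card).toRepresentation

/-- A complex representation of `S_n` is chiral if its determinant is the sign character and is
non-trivial.  Non-triviality is automatic for `n ≥ 2`; it excludes the degenerate groups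
`S_0`, `S_1`, for which the sign character is trivial. -/
def IsChiralRep {n : ℕ} {V : Type*} [AddCommGroup V] [Module ℂ V]
    (ρ : Representation ℂ (Equiv.Perm (Fin n)) V) : Prop :=
  (∀ g, LinearMap.det (ρ g) = ((Equiv.Perm.sign g : ℤ) : ℂ)) ∧ ∃ g, LinearMap.det (ρ g) ≠ 1

/-- A partition (Young diagram) is chiral if its Specht representation is. -/
def IsChiral (μ : YoungDiagram) : Prop :=
  IsChiralRep (V := (spechtModule μ μ.card).toSubmodule) (spechtRep μ)

theorem hook_sortedGE (a b : ℕ) : ((a + 1) :: List.replicate b 1).SortedGE := by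
  rw [List.sortedGE_iff_pairwise, List.pairwise_cons]
  refine ⟨fun x hx => ?_, List.pairwise_replicate.2 (Or.inr le_rfl)⟩
  rw [List.eq_of_mem_replicate hx]
  omega

/-- The hook `h(a,b) = (a+1, 1^b)`. -/
def hook (a b : ℕ) : YoungDiagram :=
  YoungDiagram.ofRowLens ((a + 1) :: List.replicate b 1) (hook_sortedGE a b)

/-- The number of times `1` occurs in the binary expansion of `n`. -/
def binaryOnes (n : ℕ) : ℕ := (Nat.digits 2 n).count 1

/-! Transpositions generate `S_n`, so for `n ≥ 2` chirality means that every transposition has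
determinant -1. A transposition acts as an involution, whose determinant is (-1)^d with d the
dimension of its -1 eigenspace. It remains to find d for the hook with leg `b = k + 1`.

For a hook only the first column matters. A tabloid is an injective `b`-tuple `u` (the entries below
the first row) and a polytabloid is an alternating sum over orderings of `b + 1` column entries.
Vectors of the Specht module therefore alternate in `u` and satisfy one linear relation, the sum
over a free first entry (`spechtModule_hook_sum_apply_cons`). If moreover the swap of `x` and `y`
negates `v`, these relations express `v` through its coefficients at the tuples formed by `y` and a
`k`-set `B` avoiding `x` and `y` (`spechtModule_hook_eq_zero_of_anti`). The polytabloids with first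
column `x`, `y`, `B` are dual to those coefficients (`hookPolytabloid_pairColumn_apply`). Hence d is
the number of such `B`, namely `(n - 2).choose k`, and `n - 2 = a + k` turns this into the stated
binomial by symmetry.

The count then asks for the odd entries in row `n - 2` of Pascal's triangle, which Lucas' theorem
supplies. -/

theorem LinearMap.det_eq_neg_one_pow_of_involutive {V : Type*} [AddCommGroup V] [Module ℂ V]
    [FiniteDimensional ℂ V] (s : V →ₗ[ℂ] V) (hs : ∀ v, s (s v) = v) :
    LinearMap.det s = (-1) ^ Module.finrank ℂ (LinearMap.ker (s + 1)) := by
  -- Averaging splits the space: `v` is half of `v + s v` plus half of `v - s v`. So `s` is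
  -- conjugate to the identity on one summand and its negative on the other.
  have hc : IsCompl (LinearMap.ker (s - 1)) (LinearMap.ker (s + 1)) := by
    refine ⟨?_, ?_⟩
    · rw [Submodule.disjoint_def]
      intro v h1 h2
      simp only [LinearMap.mem_ker, LinearMap.sub_apply, LinearMap.add_apply, Module.End.one_apply]
        at h1 h2
      have h3 : (2 : ℂ) • v = 0 := by
        rw [two_smul]
        calc v + v = (s v + v) - (s v - v) := by abel
          _ = 0 := by rw [h1, h2, sub_zero]
      simpa using h3
    · rw [Submodule.codisjoint_iff_exists_add_eq]
      intro v
      refine ⟨(1 / 2 : ℂ) • (v + s v), (1 / 2 : ℂ) • (v - s v), ?_, ?_, ?_⟩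
      · simp [hs, add_comm]
      · simp [hs]
      · module
  let e := Submodule.prodEquivOfIsCompl _ _ hc
  have h : s = (e : _ →ₗ[ℂ] V) ∘ₗ (LinearMap.prodMap LinearMap.id (-LinearMap.id)) ∘ₗ
      e.symm.toLinearMap := by
    ext v
    obtain ⟨⟨⟨p, hp⟩, ⟨q, hq⟩⟩, rfl⟩ := e.surjective v
    have hp' : s p = p := by simpa [sub_eq_zero] using hp
    have hq' : s q = -q := by simpa [add_eq_zero_iff_eq_neg] using hq
    simp only [LinearMap.comp_apply, LinearEquiv.coe_coe, e.symm_apply_apply]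
    simp [e, hp', hq']
  refine (congrArg LinearMap.det h).trans ?_
  rw [ LinearMap.det_conj, LinearMap.det_prodMap, LinearMap.det_id, one_mul,
    ← neg_one_smul ℂ LinearMap.id, LinearMap.det_smul, LinearMap.det_id, mul_one]

/-! ### Binomial coefficients modulo 2 -/

theorem Nat.choose_two_mul_mod_two (q j : ℕ) : (2 * q).choose (2 * j) % 2 = q.choose j % 2 := by
  have := Choose.choose_modEq_choose_mod_mul_choose_div_nat (p := 2) (n := 2 * q) (k := 2 * j)
  simpa [Nat.ModEq] using this

theorem Nat.choose_two_mul_succ_mod_two (q j : ℕ) : (2 * q).choose (2 * j + 1) % 2 = 0 := by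
  have := Choose.choose_modEq_choose_mod_mul_choose_div_nat (p := 2) (n := 2 * q) (k := 2 * j + 1)
  simpa [Nat.ModEq, Nat.mul_add_mod] using this

theorem Nat.choose_two_mul_add_one_mod_two (q j : ℕ) :
    (2 * q + 1).choose (2 * j) % 2 = q.choose j % 2 := by
  have := Choose.choose_modEq_choose_mod_mul_choose_div_nat (p := 2) (n := 2 * q + 1) (k := 2 * j)
  have h : (2 * q + 1) / 2 = q := by omega
  simpa [Nat.ModEq, Nat.mul_add_mod, h] using this

theorem Nat.choose_two_mul_add_one_succ_mod_two (q j : ℕ) :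
    (2 * q + 1).choose (2 * j + 1) % 2 = q.choose j % 2 := by
  have := Choose.choose_modEq_choose_mod_mul_choose_div_nat (p := 2) (n := 2 * q + 1)
    (k := 2 * j + 1)
  have h : (2 * q + 1) / 2 = q := by omega
  have h' : (2 * j + 1) / 2 = j := by omega
  simpa [Nat.ModEq, Nat.mul_add_mod, h, h'] using this

theorem Nat.sum_range_two_mul {M : Type*} [AddCommMonoid M] (f : ℕ → M) (n : ℕ) :
    ∑ j ∈ Finset.range (2 * n), f j = ∑ j ∈ Finset.range n, (f (2 * j) + f (2 * j + 1)) := by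
  induction n with
  | zero => simp
  | succ n ih =>
    rw [Finset.sum_range_succ, ← ih, show 2 * (n + 1) = 2 * n + 1 + 1 by ring,
      Finset.sum_range_succ, Finset.sum_range_succ, add_assoc]

/-- By Lucas modulo 2, row `2 * q` is row `q` interleaved with zeros, and row `2 * q + 1` is row `q`
with each entry doubled up. Thus appending a binary digit 0 preserves the sum and appending 1
doubles it. -/
theorem sum_choose_mod_two (m : ℕ) :
    ∑ j ∈ Finset.range (m + 1), m.choose j % 2 = 2 ^ binaryOnes m := by
  induction m using Nat.strong_induction_on with
  | _ m ih =>
    obtain ⟨q, rfl | rfl⟩ := Nat.even_or_odd' m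
    · rcases Nat.eq_zero_or_pos q with rfl | hq
      · simp [binaryOnes]
      · have hd : binaryOnes (2 * q) = binaryOnes q := by
          simp [binaryOnes, Nat.digits_def' (b := 2) (n := 2 * q) (by norm_num) (by omega)]
        rw [hd, ← ih q (by omega), Finset.sum_range_succ, Nat.sum_range_two_mul,
          Finset.sum_range_succ, Nat.choose_two_mul_mod_two]
        simp [Nat.choose_two_mul_mod_two, Nat.choose_two_mul_succ_mod_two]
    · have hd : binaryOnes (2 * q + 1) = binaryOnes q + 1 := by
        have h : (2 * q + 1) / 2 = q := by omega
        have h' : (2 * q + 1) % 2 = 1 := by omega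
        simp [binaryOnes, h, h']
      rw [hd, pow_succ, ← ih q (by omega), show 2 * q + 1 + 1 = 2 * (q + 1) by ring,
        Nat.sum_range_two_mul, Finset.sum_mul]
      refine Finset.sum_congr rfl fun j _ => ?_
      rw [Nat.choose_two_mul_add_one_mod_two, Nat.choose_two_mul_add_one_succ_mod_two]
      ring

theorem card_filter_odd_choose (m : ℕ) :
    ((Finset.range (m + 1)).filter fun j => Odd (m.choose j)).card = 2 ^ binaryOnes m := by
  rw [← sum_choose_mod_two, Finset.card_filter]
  refine Finset.sum_congr rfl fun j _ => ?_
  rcases Nat.mod_two_eq_zero_or_one (m.choose j) with h | h <;> simp [Nat.odd_iff, h]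

/-! ### Hook shapes and the count of chiral hooks -/

theorem mem_hook {a b : ℕ} {c : ℕ × ℕ} :
    c ∈ hook a b ↔ (c.1 = 0 ∧ c.2 ≤ a) ∨ (c.2 = 0 ∧ c.1 ≤ b) := by
  obtain ⟨i, j⟩ := c
  rw [hook, YoungDiagram.mem_ofRowLens]
  rcases i with _ | i
  · simp
    omega
  · simp
    omega

theorem hook_cells (a b : ℕ) :
    (hook a b).cells = (Finset.range (a + 1)).image (fun j => (0, j)) ∪
      (Finset.range b).image (fun i => (i + 1, 0)) := by
  ext ⟨i, j⟩
  rw [YoungDiagram.mem_cells, mem_hook]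
  simp only [Finset.mem_union, Finset.mem_image, Finset.mem_range, Prod.mk.injEq]
  constructor
  · rintro (⟨rfl, h⟩ | ⟨rfl, h⟩)
    · exact Or.inl ⟨j, by omega, rfl, rfl⟩
    · rcases i with _ | i
      · exact Or.inl ⟨0, by omega, rfl, rfl⟩
      · exact Or.inr ⟨i, by omega, rfl, rfl⟩
  · rintro (⟨j, h, rfl, rfl⟩ | ⟨i, h, rfl, rfl⟩)
    · exact Or.inl ⟨rfl, by omega⟩
    · exact Or.inr ⟨rfl, by omega⟩

theorem card_hook (a b : ℕ) : (hook a b).card = a + b + 1 := by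
  rw [YoungDiagram.card, hook_cells, Finset.card_union_of_disjoint, Finset.card_image_of_injective,
    Finset.card_image_of_injective, Finset.card_range, Finset.card_range]
  · omega
  · intro i j h
    simpa using h
  · intro i j h
    simpa using h
  · simp [Finset.disjoint_left]

theorem hook_injective {a b a' b' : ℕ} (h : hook a b = hook a' b') : a = a' ∧ b = b' := by
  have h1 : ∀ c, c ∈ hook a b ↔ c ∈ hook a' b' := by simp [h]
  simp only [mem_hook] at h1
  have := h1 (0, a)
  have := h1 (0, a')
  have := h1 (b, 0)
  have := h1 (b', 0)
  simp at *
  omega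

theorem ncard_chiral_hooks
    (H : ∀ a b : ℕ, IsChiral (hook a b) ↔ 0 < b ∧ Odd ((a + b - 1).choose a)) (n : ℕ)
    (hn : 2 ≤ n) :
    {μ : YoungDiagram | μ.card = n ∧ (∃ a b : ℕ, μ = hook a b) ∧ IsChiral μ}.ncard
      = 2 ^ binaryOnes (n - 2) := by
  -- Hooks of size `n` are parametrized by the arm `a`, which the diagram determines even where `n -
  -- 1 - a` truncates. The range `a < n - 2 + 1` encodes a positive leg.
  rw [← card_filter_odd_choose, ← Set.ncard_coe_finset,
    ← Set.ncard_image_of_injective (f := fun a => hook a (n - 1 - a)) _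
      (fun a a' h => (hook_injective h).1)]
  congr 1
  ext μ
  simp only [Set.mem_ofPred_eq, Set.mem_image, Finset.coe_filter, Finset.mem_range]
  constructor
  · rintro ⟨hc, ⟨a, b, rfl⟩, h⟩
    rw [card_hook] at hc
    obtain ⟨hb, ho⟩ := (H a b).1 h
    refine ⟨a, ⟨by omega, ?_⟩, ?_⟩
    · rwa [show n - 2 = a + b - 1 by omega]
    · rw [show n - 1 - a = b by omega]
  · rintro ⟨a, ⟨ha, ho⟩, rfl⟩
    refine ⟨by rw [card_hook]; omega, ⟨_, _, rfl⟩, (H _ _).2 ⟨by omega, ?_⟩⟩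
    rwa [show a + (n - 1 - a) - 1 = n - 2 by omega]

/-! ### Hook tabloids and polytabloids as tuples -/

/-- The tabloid of hook shape whose entries in the rows `1, …, b` are given by `u`. -/
noncomputable def hookTabloid {b n : ℕ} (u : Fin b → Fin n) : Fin n → ℕ :=
  Function.extend u (fun i => (i : ℕ) + 1) 0

/-- The labels `i + 1` are distinct and differ from the default 0, so the label of `u' i` tells
where it sits in `u`. Injectivity of one side suffices; this makes coefficients at tuples with
repeated entries vanish later. -/
theorem hookTabloid_eq_iff {b n : ℕ} {u u' : Fin b → Fin n} (hu' : Function.Injective u') :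
    hookTabloid u' = hookTabloid u ↔ u' = u := by
  classical
  refine ⟨fun h => ?_, fun h => by rw [h]⟩
  funext i
  have h1 := congrFun h (u' i)
  rw [hookTabloid, hu'.extend_apply, hookTabloid, Function.extend_def] at h1
  split_ifs at h1 with h2
  · have h3 : i = Classical.choose h2 := Fin.ext (by omega)
    exact ((congrArg u h3).trans (Classical.choose_spec h2)).symm

theorem hookTabloid_comp_inv {b n : ℕ} {u : Fin b → Fin n} (hu : Function.Injective u)
    (g : Equiv.Perm (Fin n)) : hookTabloid u ∘ ⇑g⁻¹ = hookTabloid (⇑g ∘ u) := by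
  funext z
  obtain ⟨z, rfl⟩ := g.surjective z
  by_cases hz : ∃ i, u i = z
  · obtain ⟨i, rfl⟩ := hz
    have := (g.injective.comp hu).extend_apply (fun i => (i : ℕ) + 1) 0 i
    simp only [Function.comp_apply] at this
    simp [hookTabloid, this, hu.extend_apply]
  · have hz' : ¬∃ i, (⇑g ∘ u) i = g z := by simpa using hz
    simp [hookTabloid, Function.extend_apply' _ _ _ hz, Function.extend_apply' _ _ _ hz']

/-- The hook polytabloid of a tableau with first column `t`. -/
noncomputable def hookPolytabloid {b n : ℕ} (t : Fin (b + 1) → Fin n) : (Fin n → ℕ) →₀ ℂ :=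
  ∑ π : Equiv.Perm (Fin (b + 1)),
    Finsupp.single (hookTabloid fun i => t (π i.succ)) ((Equiv.Perm.sign π : ℤ) : ℂ)

theorem injective_comp_perm_succ {b n : ℕ} {t : Fin (b + 1) → Fin n} (ht : Function.Injective t)
    (π : Equiv.Perm (Fin (b + 1))) : Function.Injective fun i : Fin b => t (π i.succ) :=
  ht.comp (π.injective.comp (Fin.succ_injective b))

theorem hookPolytabloid_apply {b n : ℕ} {t : Fin (b + 1) → Fin n} (ht : Function.Injective t)
    (u : Fin b → Fin n) :
    hookPolytabloid t (hookTabloid u) = ∑ π : Equiv.Perm (Fin (b + 1)),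
      if (fun i => t (π i.succ)) = u then ((Equiv.Perm.sign π : ℤ) : ℂ) else 0 := by
  classical
  rw [hookPolytabloid, Finsupp.finsetSum_apply]
  refine Finset.sum_congr rfl fun π _ => ?_
  rw [Finsupp.single_apply]
  simp only [hookTabloid_eq_iff (injective_comp_perm_succ ht π)]

theorem rowAssignmentRep_single {n : ℕ} (g : Equiv.Perm (Fin n)) (f : Fin n → ℕ) (c : ℂ) :
    rowAssignmentRep n g (Finsupp.single f c) = Finsupp.single (f ∘ ⇑g⁻¹) c := by
  simp [rowAssignmentRep, Finsupp.mapDomain_single]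

theorem rowAssignmentRep_hookPolytabloid {b n : ℕ} {t : Fin (b + 1) → Fin n}
    (ht : Function.Injective t) (g : Equiv.Perm (Fin n)) :
    rowAssignmentRep n g (hookPolytabloid t) = hookPolytabloid (⇑g ∘ t) := by
  rw [hookPolytabloid, map_sum]
  refine Finset.sum_congr rfl fun π _ => ?_
  rw [rowAssignmentRep_single, hookTabloid_comp_inv (injective_comp_perm_succ ht π)]
  rfl

theorem rowAssignmentRep_apply_comp {n : ℕ} (g : Equiv.Perm (Fin n)) (v : (Fin n → ℕ) →₀ ℂ)
    (f : Fin n → ℕ) : rowAssignmentRep n g v (f ∘ ⇑g⁻¹) = v f := by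
  have : Function.Injective fun f : Fin n → ℕ => f ∘ ⇑g⁻¹ := g⁻¹.surjective.injective_comp_right
  exact Finsupp.mapDomain_apply this v f

theorem hookPolytabloid_comp_perm {b n : ℕ} (t : Fin (b + 1) → Fin n)
    (τ : Equiv.Perm (Fin (b + 1))) :
    hookPolytabloid (t ∘ τ) = ((Equiv.Perm.sign τ : ℤ) : ℂ) • hookPolytabloid t := by
  rw [hookPolytabloid, hookPolytabloid, Finset.smul_sum,
    ← Equiv.sum_comp (Equiv.mulLeft τ) fun π => ((Equiv.Perm.sign τ : ℤ) : ℂ) •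
      Finsupp.single (hookTabloid fun i => t (π i.succ)) ((Equiv.Perm.sign π : ℤ) : ℂ)]
  refine Finset.sum_congr rfl fun π _ => ?_
  rw [Finsupp.smul_single, Equiv.coe_mulLeft, Equiv.Perm.sign_mul, smul_eq_mul]
  congr 1
  push_cast
  rw [← mul_assoc, ← Int.cast_mul, ← Units.val_mul, Int.units_mul_self]
  simp

/-! ### Tableaux of hook shape reduced to their first column -/

section Column

variable {a b n : ℕ}

/-- The first column of a tableau of hook shape. -/
def hookColumn (T : YoungTableau (hook a b) n) (i : Fin (b + 1)) : Fin n :=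
  T ⟨(i, 0), by rw [YoungDiagram.mem_cells, mem_hook]; exact Or.inr ⟨rfl, by omega⟩⟩

theorem hookColumn_injective (T : YoungTableau (hook a b) n) :
    Function.Injective (hookColumn T) := by
  intro i j h
  have := T.injective h
  simpa [Fin.ext_iff] using this

theorem hookColumn_trans (T : YoungTableau (hook a b) n) (g : Equiv.Perm (Fin n)) :
    hookColumn (T.trans g) = ⇑g ∘ hookColumn T := rfl

theorem colOf_hookColumn (T : YoungTableau (hook a b) n) (i : Fin (b + 1)) :
    T.colOf (hookColumn T i) = 0 := by
  simp [YoungTableau.colOf, hookColumn]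

theorem rowOf_hookColumn (T : YoungTableau (hook a b) n) (i : Fin (b + 1)) :
    T.rowOf (hookColumn T i) = i := by
  simp [YoungTableau.rowOf, hookColumn]

theorem exists_hookColumn_eq (T : YoungTableau (hook a b) n) {x : Fin n} (hx : T.colOf x = 0) :
    ∃ i, hookColumn T i = x := by
  have h := mem_hook.1 ((YoungDiagram.mem_cells _).1 (T.symm x).2)
  rw [YoungTableau.colOf] at hx
  refine ⟨⟨(T.symm x).1.1, by omega⟩, ?_⟩
  rw [hookColumn, ← T.eq_symm_apply]
  exact Subtype.ext (Prod.ext rfl hx.symm)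

theorem rowOf_eq_zero_of_colOf_ne_zero (T : YoungTableau (hook a b) n) {x : Fin n}
    (hx : T.colOf x ≠ 0) : T.rowOf x = 0 := by
  have h := mem_hook.1 ((YoungDiagram.mem_cells _).1 (T.symm x).2)
  rw [YoungTableau.colOf] at hx
  rw [YoungTableau.rowOf]
  omega

theorem rowOf_eq_hookTabloid (T : YoungTableau (hook a b) n) :
    T.rowOf = hookTabloid fun i => hookColumn T i.succ := by
  have hi : Function.Injective fun i : Fin b => hookColumn T i.succ :=
    (hookColumn_injective T).comp (Fin.succ_injective b)
  funext x
  by_cases hx : ∃ i : Fin b, hookColumn T i.succ = x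
  · obtain ⟨i, rfl⟩ := hx
    rw [rowOf_hookColumn, hookTabloid, hi.extend_apply (fun i : Fin b => (i : ℕ) + 1) 0 i]
    simp
  · rw [hookTabloid, Function.extend_apply' _ _ _ hx]
    by_cases hc : T.colOf x = 0
    · obtain ⟨i, rfl⟩ := exists_hookColumn_eq T hc
      rw [rowOf_hookColumn]
      rcases Fin.eq_zero_or_eq_succ i with rfl | ⟨j, rfl⟩
      · rfl
      · exact absurd ⟨j, rfl⟩ hx
    · exact rowOf_eq_zero_of_colOf_ne_zero T hc

theorem eq_of_colOf_eq_of_ne_zero (T : YoungTableau (hook a b) n) {x y : Fin n}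
    (h : T.colOf x = T.colOf y) (hy : T.colOf y ≠ 0) : x = y := by
  have h1 := rowOf_eq_zero_of_colOf_ne_zero T hy
  have h2 := rowOf_eq_zero_of_colOf_ne_zero T (h ▸ hy)
  exact T.symm.injective (Subtype.ext (Prod.ext (h2.trans h1.symm) h))

/-- The entries of the first column. -/
noncomputable def hookColumnEquiv (T : YoungTableau (hook a b) n) :
    Fin (b + 1) ≃ {x // T.colOf x = 0} :=
  Equiv.ofBijective (fun i => ⟨hookColumn T i, colOf_hookColumn T i⟩)
    ⟨fun _ _ h => hookColumn_injective T (congrArg Subtype.val h),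
      fun x => (exists_hookColumn_eq T x.2).imp fun _ h => Subtype.ext h⟩

theorem extendDomain_hookColumn (T : YoungTableau (hook a b) n)
    (π : Equiv.Perm (Fin (b + 1))) (i : Fin (b + 1)) :
    π.extendDomain (hookColumnEquiv T) (hookColumn T i) = hookColumn T (π i) :=
  Equiv.Perm.extendDomain_apply_image π (hookColumnEquiv T) i

/-- All columns but the first are single cells, so the column stabilizer consists exactly of the
permutations of the first column's entries, extended by the identity. -/
theorem polytabloid_eq_hookPolytabloid (T : YoungTableau (hook a b) n) :
    polytabloid T = hookPolytabloid (hookColumn T) := by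
  classical
  rw [polytabloid, hookPolytabloid]
  symm
  have hmem : ∀ π : Equiv.Perm (Fin (b + 1)),
      π.extendDomain (hookColumnEquiv T) ∈ T.colStabilizer := by
    intro π x
    by_cases hx : T.colOf x = 0
    · obtain ⟨i, rfl⟩ := exists_hookColumn_eq T hx
      rw [extendDomain_hookColumn, colOf_hookColumn, colOf_hookColumn]
    · rw [Equiv.Perm.extendDomain_apply_not_subtype π (hookColumnEquiv T) hx]
  refine Fintype.sum_bijective (fun π => ⟨π.extendDomain (hookColumnEquiv T), hmem π⟩)
    ⟨fun π π' h => ?_, fun σ => ?_⟩ _ _ fun π => ?_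
  · ext i
    have h1 := Equiv.congr_fun (congrArg Subtype.val h) (hookColumn T i)
    simp only [extendDomain_hookColumn] at h1
    rw [hookColumn_injective T h1]
  · have hσ : ∀ x, T.colOf (σ.1 x) = T.colOf x := σ.2
    have hσ' : ∀ x, T.colOf (σ.1 x) = 0 ↔ T.colOf x = 0 := fun x => by rw [hσ]
    refine ⟨(hookColumnEquiv T).symm.permCongr (σ.1.subtypePerm hσ'), ?_⟩
    · ext1
      ext1 x
      by_cases hx : T.colOf x = 0
      · obtain ⟨i, rfl⟩ := exists_hookColumn_eq T hx
        rw [extendDomain_hookColumn]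
        exact congrArg Subtype.val ((hookColumnEquiv T).apply_symm_apply
          (σ.1.subtypePerm hσ' (hookColumnEquiv T i)))
      · exact (Equiv.Perm.extendDomain_apply_not_subtype _ (hookColumnEquiv T) hx).trans
          (eq_of_colOf_eq_of_ne_zero T (hσ x) hx).symm
  · rw [rowOf_eq_hookTabloid, hookColumn_trans]
    simp [extendDomain_hookColumn, Equiv.Perm.sign_extendDomain]

/-- Take any tableau and compose it with a permutation that carries its first column to `t`. -/
theorem exists_hookColumn (hn : n = a + b + 1) {t : Fin (b + 1) → Fin n}
    (ht : Function.Injective t) : ∃ T : YoungTableau (hook a b) n, hookColumn T = t := by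
  classical
  have hcard : Fintype.card (hook a b).cells = Fintype.card (Fin n) := by
    rw [Fintype.card_coe, Fintype.card_fin, hn]
    exact card_hook a b
  obtain ⟨T⟩ : Nonempty (YoungTableau (hook a b) n) := Fintype.card_eq.1 hcard
  obtain ⟨g, hg⟩ := Set.MapsTo.exists_equiv_extend_of_card_eq (α := Fin n)
    (t := (Finset.univ : Finset (Fin n))) (by simp) (s := Set.range (hookColumn T))
    (f := fun x => Function.extend (hookColumn T) t id x) (fun _ _ => by simp) (by
      rintro _ ⟨i, rfl⟩ _ ⟨j, rfl⟩ h
      simp only [(hookColumn_injective T).extend_apply] at h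
      rw [ht h])
  refine ⟨T.trans (g.trans (Equiv.subtypeUnivEquiv (fun x => Finset.mem_univ x))), ?_⟩
  funext i
  have := hg _ ⟨i, rfl⟩
  rw [(hookColumn_injective T).extend_apply] at this
  exact this

theorem spechtModule_hook (hn : n = a + b + 1) :
    (spechtModule (hook a b) n).toSubmodule =
      Submodule.span ℂ {v | ∃ t : Fin (b + 1) → Fin n, Function.Injective t ∧
        hookPolytabloid t = v} := by
  change Submodule.span ℂ _ = _
  congr 1
  ext v
  constructor
  · rintro ⟨T, rfl⟩
    exact ⟨_, hookColumn_injective T, (polytabloid_eq_hookPolytabloid T).symm⟩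
  · rintro ⟨t, ht, rfl⟩
    obtain ⟨T, rfl⟩ := exists_hookColumn hn ht
    exact ⟨T, polytabloid_eq_hookPolytabloid T⟩

end Column

/-! ### Linear relations between coefficients in the Specht module -/

theorem hookPolytabloid_apply_comp_perm {b n : ℕ} {t : Fin (b + 1) → Fin n}
    (ht : Function.Injective t) (u : Fin b → Fin n) (ρ : Equiv.Perm (Fin b)) :
    hookPolytabloid t (hookTabloid (u ∘ ρ)) =
      ((Equiv.Perm.sign ρ : ℤ) : ℂ) * hookPolytabloid t (hookTabloid u) := by
  rw [hookPolytabloid_apply ht, hookPolytabloid_apply ht, Finset.mul_sum,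
    ← Equiv.sum_comp (Equiv.mulRight (Equiv.Perm.decomposeFin.symm (0, ρ)))]
  refine Finset.sum_congr rfl fun π _ => ?_
  have h : (fun i : Fin b => t ((π * Equiv.Perm.decomposeFin.symm (0, ρ)) i.succ)) =
      (fun i => t (π i.succ)) ∘ ρ := by
    funext i
    simp
  simp only [Equiv.coe_mulRight, h, ρ.surjective.injective_comp_right.eq_iff]
  simp [mul_comm]

/-- Once `z` is free, the condition on `π` no longer involves its values at 0 and 1. Right
multiplication by the swap of 0 and 1 then pairs off terms of opposite sign. -/
theorem sum_hookPolytabloid_apply_cons {k n : ℕ} {t : Fin (k + 1 + 1) → Fin n}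
    (ht : Function.Injective t) (w : Fin k → Fin n) :
    ∑ z, hookPolytabloid t (hookTabloid (Fin.cons z w : Fin (k + 1) → Fin n)) = 0 := by
  simp only [hookPolytabloid_apply ht]
  rw [Finset.sum_comm]
  have h : ∀ π : Equiv.Perm (Fin (k + 1 + 1)),
      (∑ z, if (fun i : Fin (k + 1) => t (π i.succ)) = Fin.cons z w
        then ((Equiv.Perm.sign π : ℤ) : ℂ) else 0) =
      if (fun i : Fin k => t (π i.succ.succ)) = w then ((Equiv.Perm.sign π : ℤ) : ℂ) else 0 := by
    intro π
    have h1 : ∀ z, ((fun i : Fin (k + 1) => t (π i.succ)) = Fin.cons z w) ↔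
        (t (π 1) = z ∧ (fun i : Fin k => t (π i.succ.succ)) = w) := by
      intro z
      simp [funext_iff, Fin.forall_fin_succ (n := k)]
    simp only [h1, ite_and, Finset.sum_ite_eq, Finset.mem_univ, if_true]
  rw [Finset.sum_congr rfl fun π _ => h π]
  refine self_eq_neg.1 ?_
  rw [← Finset.sum_neg_distrib]
  nth_rw 1 [← Equiv.sum_comp (Equiv.mulRight (Equiv.swap 0 1))]
  refine Finset.sum_congr rfl fun π _ => ?_
  have h2 : ∀ i : Fin k, (π * Equiv.swap (0 : Fin (k + 1 + 1)) 1) i.succ.succ = π i.succ.succ := by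
    intro i
    rw [Equiv.Perm.mul_apply, Equiv.swap_apply_of_ne_of_ne]
    · exact Fin.succ_ne_zero _
    · rw [← Fin.succ_zero_eq_one]
      exact fun h => Fin.succ_ne_zero _ (Fin.succ_injective _ h)
  simp only [Equiv.coe_mulRight, h2]
  split_ifs <;> simp

section Specht

variable {a b k n : ℕ}

theorem mem_spechtModule_hook (hn : n = a + b + 1) {v : (Fin n → ℕ) →₀ ℂ} :
    v ∈ (spechtModule (hook a b) n).toSubmodule ↔
      v ∈ Submodule.span ℂ {v | ∃ t : Fin (b + 1) → Fin n, Function.Injective t ∧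
        hookPolytabloid t = v} := by
  rw [spechtModule_hook hn]

theorem spechtModule_hook_apply_comp_perm (hn : n = a + b + 1) {v : (Fin n → ℕ) →₀ ℂ}
    (hv : v ∈ (spechtModule (hook a b) n).toSubmodule) (u : Fin b → Fin n)
    (ρ : Equiv.Perm (Fin b)) :
    v (hookTabloid (u ∘ ρ)) = ((Equiv.Perm.sign ρ : ℤ) : ℂ) * v (hookTabloid u) := by
  rw [mem_spechtModule_hook hn] at hv
  induction hv using Submodule.span_induction with
  | mem v hv =>
    obtain ⟨t, ht, rfl⟩ := hv
    exact hookPolytabloid_apply_comp_perm ht u ρ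
  | zero => simp
  | add v w _ _ hv hw => rw [Finsupp.add_apply, hv, hw, Finsupp.add_apply, mul_add]
  | smul c v _ hv => rw [Finsupp.smul_apply, hv, Finsupp.smul_apply, smul_eq_mul, smul_eq_mul,
      mul_left_comm]

theorem spechtModule_hook_sum_apply_cons (hn : n = a + (k + 1) + 1) {v : (Fin n → ℕ) →₀ ℂ}
    (hv : v ∈ (spechtModule (hook a (k + 1)) n).toSubmodule) (w : Fin k → Fin n) :
    ∑ z, v (hookTabloid (Fin.cons z w : Fin (k + 1) → Fin n)) = 0 := by
  rw [mem_spechtModule_hook hn] at hv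
  induction hv using Submodule.span_induction with
  | mem v hv =>
    obtain ⟨t, ht, rfl⟩ := hv
    exact sum_hookPolytabloid_apply_cons ht w
  | zero => simp
  | add v w _ _ hv hw => simp only [Finsupp.add_apply, Finset.sum_add_distrib, hv, hw, add_zero]
  | smul c v _ hv => simp only [Finsupp.smul_apply, ← Finset.smul_sum, hv, smul_zero]

theorem spechtModule_hook_exists_hookTabloid (hn : n = a + b + 1) {v : (Fin n → ℕ) →₀ ℂ}
    (hv : v ∈ (spechtModule (hook a b) n).toSubmodule) {f : Fin n → ℕ} (hf : v f ≠ 0) :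
    ∃ u : Fin b → Fin n, Function.Injective u ∧ hookTabloid u = f := by
  classical
  rw [mem_spechtModule_hook hn] at hv
  contrapose! hf
  induction hv using Submodule.span_induction with
  | mem v hv =>
    obtain ⟨t, ht, rfl⟩ := hv
    rw [hookPolytabloid, Finsupp.finsetSum_apply]
    exact Finset.sum_eq_zero fun π _ =>
      Finsupp.single_eq_of_ne' (hf _ (injective_comp_perm_succ ht π))
  | zero => simp
  | add v w _ _ hv hw => simp [hv, hw]
  | smul c v _ hv => simp [hv]

theorem Function.Injective.exists_perm_of_range_eq {α β : Type*} {u u' : α → β}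
    (hu : Function.Injective u) (hu' : Function.Injective u') (h : Set.range u = Set.range u') :
    ∃ ρ : Equiv.Perm α, u' ∘ ρ = u := by
  refine ⟨((Equiv.ofInjective u hu).trans (Equiv.setCongr h)).trans
    (Equiv.ofInjective u' hu').symm, ?_⟩
  funext i
  exact congrArg Subtype.val ((Equiv.ofInjective u' hu').apply_symm_apply _)

theorem spechtModule_hook_apply_eq_zero_of_range_eq (hn : n = a + b + 1) {v : (Fin n → ℕ) →₀ ℂ}
    (hv : v ∈ (spechtModule (hook a b) n).toSubmodule) {u u' : Fin b → Fin n}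
    (hu : Function.Injective u) (hu' : Function.Injective u') (h : Set.range u = Set.range u')
    (h0 : v (hookTabloid u') = 0) : v (hookTabloid u) = 0 := by
  obtain ⟨ρ, rfl⟩ := hu.exists_perm_of_range_eq hu' h
  rw [spechtModule_hook_apply_comp_perm hn hv, h0, mul_zero]

/-- An injective tuple can be reordered so as to start with any of its values. -/
theorem Function.Injective.exists_cons_range_eq {β : Type*} {u : Fin (k + 1) → β}
    (hu : Function.Injective u) (i : Fin (k + 1)) :
    ∃ w : Fin k → β, Function.Injective w ∧ u i ∉ Set.range w ∧
      Function.Injective (Fin.cons (u i) w : Fin (k + 1) → β) ∧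
      Set.range u = Set.range (Fin.cons (u i) w : Fin (k + 1) → β) := by
  have h1 : Function.Injective (u ∘ i.succAbove) := hu.comp Fin.succAbove_right_injective
  have h2 : u i ∉ Set.range (u ∘ i.succAbove) := by
    rintro ⟨j, hj⟩
    exact Fin.succAbove_ne i j (hu hj)
  refine ⟨u ∘ i.succAbove, h1, h2, Fin.cons_injective_iff.2 ⟨h2, h1⟩, ?_⟩
  rw [Fin.range_cons]
  ext z
  constructor
  · rintro ⟨j, rfl⟩
    rcases Fin.eq_self_or_eq_succAbove i j with rfl | ⟨l, rfl⟩
    · exact Or.inl rfl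
    · exact Or.inr ⟨l, rfl⟩
  · rintro (rfl | ⟨j, rfl⟩)
    · exact ⟨i, rfl⟩
    · exact ⟨_, rfl⟩

/-- Tuples containing `y` but not `x` are covered by `h0` after reordering. The swap reduces `x`
without `y` to that case, and forces a coefficient to equal its negative when neither occurs. The
sum relation handles tuples containing both. -/
theorem spechtModule_hook_eq_zero_of_anti (hn : n = a + (k + 1) + 1) {v : (Fin n → ℕ) →₀ ℂ}
    (hv : v ∈ (spechtModule (hook a (k + 1)) n).toSubmodule) {x y : Fin n} (hxy : x ≠ y)
    (hs : rowAssignmentRep n (Equiv.swap x y) v = -v)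
    (h0 : ∀ w : Fin k → Fin n, Function.Injective w → x ∉ Set.range w → y ∉ Set.range w →
      v (hookTabloid (Fin.cons y w : Fin (k + 1) → Fin n)) = 0) : v = 0 := by
  have hsw : ∀ u : Fin (k + 1) → Fin n, Function.Injective u →
      v (hookTabloid (⇑(Equiv.swap x y) ∘ u)) = -v (hookTabloid u) := by
    intro u hu
    have h := rowAssignmentRep_apply_comp (Equiv.swap x y) v (hookTabloid u)
    rw [hs, hookTabloid_comp_inv hu, Finsupp.neg_apply] at h
    rw [← h, neg_neg]
  have hy : ∀ u : Fin (k + 1) → Fin n, Function.Injective u → x ∉ Set.range u →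
      y ∈ Set.range u → v (hookTabloid u) = 0 := by
    rintro u hu hx ⟨i, rfl⟩
    obtain ⟨w, hw, hyw, hc, hr⟩ := hu.exists_cons_range_eq i
    refine spechtModule_hook_apply_eq_zero_of_range_eq hn hv hu hc hr (h0 w hw ?_ hyw)
    rw [hr] at hx
    rintro ⟨j, rfl⟩
    exact hx ⟨j.succ, rfl⟩
  have hx : ∀ u : Fin (k + 1) → Fin n, Function.Injective u → y ∉ Set.range u →
      v (hookTabloid u) = 0 := by
    intro u hu hyu
    have h1 := hsw u hu
    by_cases hxu : x ∈ Set.range u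
    · rw [hy _ ((Equiv.swap x y).injective.comp hu)] at h1
      · simpa using h1
      · rintro ⟨j, hj⟩
        exact hyu ⟨j, by simpa [Equiv.swap_apply_eq_iff] using hj⟩
      · obtain ⟨j, hj⟩ := hxu
        exact ⟨j, by simp [hj]⟩
    · have h2 : ⇑(Equiv.swap x y) ∘ u = u := by
        funext j
        exact Equiv.swap_apply_of_ne_of_ne (fun h => hxu ⟨j, h⟩) (fun h => hyu ⟨j, h⟩)
      rw [h2] at h1
      exact self_eq_neg.1 h1
  have hall : ∀ u : Fin (k + 1) → Fin n, Function.Injective u → v (hookTabloid u) = 0 := by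
    intro u hu
    by_cases hyu : y ∈ Set.range u
    · by_cases hxu : x ∈ Set.range u
      · obtain ⟨i, rfl⟩ := hxu
        obtain ⟨w, hw, hxw, hc, hr⟩ := hu.exists_cons_range_eq i
        refine spechtModule_hook_apply_eq_zero_of_range_eq hn hv hu hc hr ?_
        have hyw : y ∈ Set.range w := by
          rw [hr, Fin.range_cons] at hyu
          exact hyu.resolve_left hxy.symm
        -- Here `w` contains `y` but not `x`. Every term with `z` other than `x` is zero, either by
        -- a repeated entry or by `hy`, so the term at `x` is the whole sum.
        rw [← spechtModule_hook_sum_apply_cons hn hv w]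
        symm
        refine Finset.sum_eq_single _ (fun z _ hz => ?_) (by simp)
        by_contra hne
        obtain ⟨u', hu', h⟩ := spechtModule_hook_exists_hookTabloid hn hv hne
        rw [hookTabloid_eq_iff hu'] at h
        rw [← h] at hne
        refine hne (hy u' hu' ?_ ?_)
        · rw [h, Fin.range_cons]
          rintro (h' | h')
          · exact hz h'.symm
          · exact hxw h'
        · rw [h, Fin.range_cons]
          exact Or.inr hyw
      · exact hy u hu hxu hyu
    · exact hx u hu hyu
  ext f
  by_contra hne
  obtain ⟨u, hu, rfl⟩ := spechtModule_hook_exists_hookTabloid hn hv hne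
  exact hne (hall u hu)

end Specht

/-! ### The -1 eigenspace of a transposition -/

section Reflection

variable {a k n : ℕ} {x y : Fin n}

theorem finite_spechtModule (μ : YoungDiagram) (n : ℕ) :
    FiniteDimensional ℂ (spechtModule μ n).toSubmodule :=
  FiniteDimensional.span_of_finite ℂ (Set.finite_range _)

/-- A first column with entries `x`, `y` and the elements of `B`. -/
def pairColumn (x y : Fin n) (B : Finset (Fin n)) (hB : B.card = k) : Fin (k + 1 + 1) → Fin n :=
  Fin.cons x (Fin.cons y (B.orderEmbOfFin hB) : Fin (k + 1) → Fin n)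

theorem pairColumn_injective {B : Finset (Fin n)} (hB : B.card = k) (hxy : x ≠ y) (hx : x ∉ B)
    (hy : y ∉ B) : Function.Injective (pairColumn x y B hB) := by
  rw [pairColumn, Fin.cons_injective_iff, Fin.cons_injective_iff, Fin.range_cons,
    Finset.range_orderEmbOfFin]
  refine ⟨?_, hy, (B.orderEmbOfFin hB).injective⟩
  rintro (h | h)
  · exact hxy h
  · exact hx h

theorem swap_comp_pairColumn {B : Finset (Fin n)} (hB : B.card = k) (hx : x ∉ B) (hy : y ∉ B) :
    ⇑(Equiv.swap x y) ∘ pairColumn x y B hB =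
      pairColumn x y B hB ∘ ⇑(Equiv.swap (0 : Fin (k + 1 + 1)) 1) := by
  have h1 : pairColumn x y B hB 1 = y := rfl
  have h0 : pairColumn x y B hB 0 = x := rfl
  funext i
  refine Fin.cases ?_ (fun i => ?_) i
  · simp [h0, h1]
  · refine Fin.cases ?_ (fun i => ?_) i
    · rw [Fin.succ_zero_eq_one]
      simp [h0, h1]
    · have h2 : pairColumn x y B hB i.succ.succ = B.orderEmbOfFin hB i := rfl
      have hi := B.orderEmbOfFin_mem hB i
      rw [Function.comp_apply, Function.comp_apply, h2, Equiv.swap_apply_of_ne_of_ne,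
        Equiv.swap_apply_of_ne_of_ne, h2]
      · exact Fin.succ_ne_zero _
      · rw [← Fin.succ_zero_eq_one]
        exact fun h => Fin.succ_ne_zero _ (Fin.succ_injective _ h)
      · exact fun h => hx (h ▸ hi)
      · exact fun h => hy (h ▸ hi)

theorem rowAssignmentRep_swap_pairColumn {B : Finset (Fin n)} (hB : B.card = k) (hxy : x ≠ y)
    (hx : x ∉ B) (hy : y ∉ B) :
    rowAssignmentRep n (Equiv.swap x y) (hookPolytabloid (pairColumn x y B hB)) =
      -hookPolytabloid (pairColumn x y B hB) := by
  rw [rowAssignmentRep_hookPolytabloid (pairColumn_injective hB hxy hx hy),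
    swap_comp_pairColumn hB hx hy, hookPolytabloid_comp_perm, Equiv.Perm.sign_swap (by simp)]
  simp

/-- A nonzero term places `B'` inside the column entries; since `B'` avoids `x` and `y` it lies in
`B`, and the sizes agree. When `B' = B` the positions 1 and up are prescribed, which leaves only the
identity permutation. -/
theorem hookPolytabloid_pairColumn_apply {B B' : Finset (Fin n)} (hB : B.card = k)
    (hB' : B'.card = k) (hxy : x ≠ y) (hx : x ∉ B) (hy : y ∉ B) (hx' : x ∉ B') (hy' : y ∉ B') :
    hookPolytabloid (pairColumn x y B hB)
      (hookTabloid (Fin.cons y (B'.orderEmbOfFin hB') : Fin (k + 1) → Fin n)) =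
      if B' = B then 1 else 0 := by
  have ht := pairColumn_injective hB hxy hx hy
  rw [hookPolytabloid_apply ht]
  split_ifs with h
  · subst h
    rw [Finset.sum_eq_single 1]
    · exact (if_pos rfl).trans (by simp)
    · intro π _ hπ
      refine if_neg fun h => hπ ?_
      have h1 : ∀ i : Fin (k + 1), π i.succ = i.succ := fun i => ht (congrFun h i)
      ext1 i
      refine Fin.cases ?_ h1 i
      rcases Fin.eq_zero_or_eq_succ (π 0) with h0 | ⟨j, h0⟩
      · exact h0
      · rw [← h1 j] at h0
        exact absurd (π.injective h0).symm (Fin.succ_ne_zero j)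
    · simp
  · refine Finset.sum_eq_zero fun π _ => if_neg fun hπ => h ?_
    refine Finset.eq_of_subset_of_card_le (fun z hz => ?_) (by rw [hB, hB'])
    have hz' : z ∈ Set.range (Fin.cons y (B'.orderEmbOfFin hB') : Fin (k + 1) → Fin n) := by
      rw [Fin.range_cons, Finset.range_orderEmbOfFin]
      exact Or.inr hz
    rw [← hπ] at hz'
    obtain ⟨i, rfl⟩ := hz'
    have h1 : pairColumn x y B hB (π i.succ) ∈ Set.range (pairColumn x y B hB) := ⟨_, rfl⟩
    change pairColumn x y B hB (π i.succ) ∈ B' at hz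
    change pairColumn x y B hB (π i.succ) ∈ B
    generalize pairColumn x y B hB (π i.succ) = z at hz h1
    rw [pairColumn, Fin.range_cons, Fin.range_cons, Finset.range_orderEmbOfFin] at h1
    rcases h1 with rfl | rfl | h1
    · exact absurd hz hx'
    · exact absurd hz hy'
    · exact h1

theorem mem_powersetCard_compl_pair {B : Finset (Fin n)}
    (hB : B ∈ Finset.powersetCard k ({x, y}ᶜ : Finset (Fin n))) :
    B.card = k ∧ x ∉ B ∧ y ∉ B := by
  rw [Finset.mem_powersetCard] at hB
  refine ⟨hB.2, fun h => ?_, fun h => ?_⟩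
  · simpa using hB.1 h
  · simpa using hB.1 h

variable {V : Type*} [AddCommGroup V] [Module ℂ V] {s : V →ₗ[ℂ] V}
  {ι : V →ₗ[ℂ] ((Fin n → ℕ) →₀ ℂ)}

/-- The coefficients of a vector at the tabloids with `y` in row `1` and not involving `x`. -/
noncomputable def pairCoeff (ι : V →ₗ[ℂ] ((Fin n → ℕ) →₀ ℂ)) (W : Submodule ℂ V) (x y : Fin n)
    (k : ℕ) : W →ₗ[ℂ] (Finset.powersetCard k ({x, y}ᶜ : Finset (Fin n)) → ℂ) :=
  LinearMap.pi fun B => Finsupp.lapply (hookTabloid (Fin.cons y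
    (B.1.orderEmbOfFin (mem_powersetCard_compl_pair B.2).1) : Fin (k + 1) → Fin n)) ∘ₗ
      ι ∘ₗ W.subtype

theorem pairCoeff_apply (W : Submodule ℂ V) (v : W)
    (B : Finset.powersetCard k ({x, y}ᶜ : Finset (Fin n))) :
    pairCoeff ι W x y k v B = ι v (hookTabloid (Fin.cons y
      (B.1.orderEmbOfFin (mem_powersetCard_compl_pair B.2).1) : Fin (k + 1) → Fin n)) := rfl

theorem mem_ker_add_one_iff (hι : Function.Injective ι)
    (hs : ∀ v, ι (s v) = rowAssignmentRep n (Equiv.swap x y) (ι v)) {v : V} :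
    v ∈ LinearMap.ker (s + 1) ↔ rowAssignmentRep n (Equiv.swap x y) (ι v) = -ι v := by
  rw [LinearMap.mem_ker, ← hs, ← map_neg, hι.eq_iff, ← add_eq_zero_iff_eq_neg]
  rfl

theorem pairCoeff_injective (hn : n = a + (k + 1) + 1) (hxy : x ≠ y) (hι : Function.Injective ι)
    (hr : ∀ v, v ∈ (spechtModule (hook a (k + 1)) n).toSubmodule ↔ ∃ w, ι w = v)
    (hs : ∀ v, ι (s v) = rowAssignmentRep n (Equiv.swap x y) (ι v)) :
    Function.Injective (pairCoeff ι (LinearMap.ker (s + 1)) x y k) := by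
  rw [injective_iff_map_eq_zero]
  rintro ⟨v, hv'⟩ h
  rw [mem_ker_add_one_iff hι hs] at hv'
  have hv := (hr (ι v)).2 ⟨v, rfl⟩
  refine Subtype.ext (hι ?_)
  rw [Submodule.coe_zero, map_zero]
  refine spechtModule_hook_eq_zero_of_anti hn hv hxy hv' fun w hw hxw hyw => ?_
  have hB : Finset.univ.image w ∈ Finset.powersetCard k ({x, y}ᶜ : Finset (Fin n)) := by
    rw [Finset.mem_powersetCard, Finset.card_image_of_injective _ hw, Finset.card_univ,
      Fintype.card_fin]
    refine ⟨fun z hz => ?_, rfl⟩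
    obtain ⟨i, -, rfl⟩ := Finset.mem_image.1 hz
    rw [Finset.mem_compl, Finset.mem_insert, Finset.mem_singleton]
    rintro (h | h)
    · exact hxw ⟨i, h⟩
    · exact hyw ⟨i, h⟩
  obtain ⟨hc, hxB, hyB⟩ := mem_powersetCard_compl_pair hB
  refine spechtModule_hook_apply_eq_zero_of_range_eq hn hv (Fin.cons_injective_iff.2 ⟨hyw, hw⟩) ?_
    ?_ (congrFun h ⟨_, hB⟩)
  · rw [Fin.cons_injective_iff, Finset.range_orderEmbOfFin]
    exact ⟨hyB, (Finset.orderEmbOfFin _ _).injective⟩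
  · rw [Fin.range_cons, Fin.range_cons, Finset.range_orderEmbOfFin]
    simp

/-- Swapping `x` and `y` in a first column containing both negates the polytabloid, so these
polytabloids lie in the eigenspace. Being dual to the coordinates, they realize `g` when taken with
coefficients `g B`. -/
theorem pairCoeff_surjective (hn : n = a + (k + 1) + 1) (hxy : x ≠ y) (hι : Function.Injective ι)
    (hr : ∀ v, v ∈ (spechtModule (hook a (k + 1)) n).toSubmodule ↔ ∃ w, ι w = v)
    (hs : ∀ v, ι (s v) = rowAssignmentRep n (Equiv.swap x y) (ι v)) :
    Function.Surjective (pairCoeff ι (LinearMap.ker (s + 1)) x y k) := by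
  intro g
  have hmem : ∀ B : Finset.powersetCard k ({x, y}ᶜ : Finset (Fin n)), ∃ w, ι w =
      hookPolytabloid (pairColumn x y B.1 (mem_powersetCard_compl_pair B.2).1) := by
    intro B
    obtain ⟨hc, hx, hy⟩ := mem_powersetCard_compl_pair B.2
    rw [← hr, mem_spechtModule_hook hn]
    exact Submodule.subset_span ⟨_, pairColumn_injective hc hxy hx hy, rfl⟩
  choose e he using hmem
  have hker : ∀ B, e B ∈ LinearMap.ker (s + 1) := by
    intro B
    obtain ⟨hc, hx, hy⟩ := mem_powersetCard_compl_pair B.2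
    rw [mem_ker_add_one_iff hι hs, he]
    exact rowAssignmentRep_swap_pairColumn hc hxy hx hy
  refine ⟨∑ B, g B • ⟨e B, hker B⟩, ?_⟩
  funext B'
  obtain ⟨hc', hx', hy'⟩ := mem_powersetCard_compl_pair B'.2
  simp only [pairCoeff_apply, Submodule.coe_sum, Submodule.coe_smul, map_sum, map_smul, he,
    Finsupp.finsetSum_apply, Finsupp.smul_apply]
  rw [Finset.sum_eq_single B']
  · rw [hookPolytabloid_pairColumn_apply _ _ hxy hx' hy' hx' hy']
    simp
  · intro B _ hB
    obtain ⟨hc, hx, hy⟩ := mem_powersetCard_compl_pair B.2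
    rw [hookPolytabloid_pairColumn_apply _ _ hxy hx hy hx' hy', if_neg, smul_zero]
    exact fun h => hB (Subtype.ext h.symm)
  · simp

theorem det_swap_of_spechtModule_hook [FiniteDimensional ℂ V] (hn : n = a + (k + 1) + 1)
    (hxy : x ≠ y) (hι : Function.Injective ι)
    (hr : ∀ v, v ∈ (spechtModule (hook a (k + 1)) n).toSubmodule ↔ ∃ w, ι w = v)
    (hs : ∀ v, ι (s v) = rowAssignmentRep n (Equiv.swap x y) (ι v)) :
    LinearMap.det s = (-1) ^ (n - 2).choose k := by
  rw [LinearMap.det_eq_neg_one_pow_of_involutive, (LinearEquiv.ofBijective _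
    ⟨pairCoeff_injective hn hxy hι hr hs, pairCoeff_surjective hn hxy hι hr hs⟩).finrank_eq,
    Module.finrank_fintype_fun_eq_card, Fintype.card_coe, Finset.card_powersetCard,
    Finset.card_compl, Fintype.card_fin, Finset.card_pair hxy]
  intro v
  refine hι ?_
  rw [hs, hs, ← Module.End.mul_apply, ← map_mul, Equiv.swap_mul_self, map_one]
  rfl

end Reflection

/-! ### From transpositions to chirality -/

theorem isChiralRep_iff_of_det_swap {n : ℕ} {V : Type*} [AddCommGroup V] [Module ℂ V]
    (ρ : Representation ℂ (Equiv.Perm (Fin n)) V) (hn : 2 ≤ n) {m : ℕ}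
    (h : ∀ x y, x ≠ y → LinearMap.det (ρ (Equiv.swap x y)) = (-1) ^ m) :
    IsChiralRep ρ ↔ Odd m := by
  have h01 : (⟨0, by omega⟩ : Fin n) ≠ ⟨1, by omega⟩ := by simp
  constructor
  · intro hρ
    have h1 := hρ.1 (Equiv.swap ⟨0, by omega⟩ ⟨1, by omega⟩)
    rw [h _ _ h01, Equiv.Perm.sign_swap h01] at h1
    rcases Nat.even_or_odd m with hm | hm
    · rw [hm.neg_one_pow] at h1
      norm_num at h1
    · exact hm
  · intro hm
    simp only [hm.neg_one_pow] at h
    refine ⟨fun g => ?_, _, by rw [h _ _ h01]; norm_num⟩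
    induction g using Equiv.Perm.swap_induction_on with
    | one => simp
    | swap_mul f x y hxy hf =>
      rw [map_mul, map_mul, h x y hxy, hf, Equiv.Perm.sign_mul, Equiv.Perm.sign_swap hxy]
      simp

/-- With no leg, tabloids are indexed by empty tuples, so all polytabloids coincide and the action
is trivial. -/
theorem not_isChiral_hook_zero (a : ℕ) : ¬IsChiral (hook a 0) := by
  rintro ⟨-, g, hg⟩
  refine hg ?_
  have h : spechtRep (hook a 0) g = 1 := by
    ext1 ⟨v, hv⟩
    refine Subtype.ext ?_
    change rowAssignmentRep _ g v = v
    rw [mem_spechtModule_hook (card_hook a 0)] at hv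
    induction hv using Submodule.span_induction with
    | mem v hv =>
      obtain ⟨t, ht, rfl⟩ := hv
      rw [rowAssignmentRep_hookPolytabloid ht]
      refine Finset.sum_congr rfl fun π _ => ?_
      congr 2
      exact Subsingleton.elim _ _
    | zero => simp
    | add v w _ _ hv hw => rw [map_add, hv, hw]
    | smul c v _ hv => rw [map_smul, hv]
  rw [h, map_one]

theorem isChiral_hook_iff (a b : ℕ) :
    IsChiral (hook a b) ↔ 0 < b ∧ Odd ((a + b - 1).choose a) := by
  rcases b with _ | k
  · simpa using not_isChiral_hook_zero a
  · have hc := card_hook a (k + 1)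
    have := finite_spechtModule (hook a (k + 1)) (hook a (k + 1)).card
    refine (isChiralRep_iff_of_det_swap (spechtRep (hook a (k + 1))) (by omega)
      fun x y hxy => det_swap_of_spechtModule_hook
        (V := (spechtModule (hook a (k + 1)) (hook a (k + 1)).card).toSubmodule)
        (ι := (spechtModule (hook a (k + 1)) (hook a (k + 1)).card).toSubmodule.subtype) hc hxy
        Subtype.val_injective (fun v => ⟨fun h => ⟨⟨v, h⟩, rfl⟩, fun ⟨w, h⟩ => h ▸ w.2⟩)
        fun _ => rfl).trans ?_
    rw [show (hook a (k + 1)).card - 2 = a + k by omega, show a + (k + 1) - 1 = a + k by omega,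
      Nat.choose_symm_add]
    simp

theorem mainTheorem9 :
    (∀ a b : ℕ, IsChiral (hook a b) ↔ 0 < b ∧ Odd ((a + b - 1).choose a)) ∧
    (∀ n : ℕ, 2 ≤ n →
      {μ : YoungDiagram | μ.card = n ∧ (∃ a b : ℕ, μ = hook a b) ∧ IsChiral μ}.ncard
        = 2 ^ binaryOnes (n - 2)) :=
  ⟨isChiral_hook_iff, ncard_chiral_hooks isChiral_hook_iff⟩
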